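/- Let $N\ge 2$, and let $e_i,f_i,h_i$ ($1\le i\le N$) be the standard Chevalley generators of $\mathfrak{sl}_{N+1}(\mathbb C)$, $\lambda_1,\dots,\lambda_{N+1}$ the weights of the standard representation ($\lambda_1+\dots+\lambda_{N+1}=0$), and $\alpha_i=\lambda_i-\lambda_{i+1}$ the simple roots. Let $L_{\Lambda(1)}$, $L_{\Lambda(0)}$ be finite-dimensional irreducible $\mathfrak{sl}_{N+1}$-modules with highest weights $\Lambda(1),\Lambda(0)$ and highest weight vectors $\mathbf v_1,\mathbf v_0$; put $L=L_{\Lambda(1)}\otimes L_{\Lambda(0)}$. For $\mathbf k=(k_1,\dots,k_N)\in\mathbb Z_{\ge0}^N$ let $\Lambda(\mathbf k)=\Lambda(1)+\Lambda(0)-\sum_i k_i\alpha_i$, and let $\mathbf t=(t_l(i))_{1\le i\le N,\,1\le l\le k_i}$ be complex numbers that are pairwise distinct and different from $0$ and $1$. The universal weight function is $$\mathbf v_{\mathbf k}(\mathbf t)=\sum_{(\mathbf F_1,\mathbf F_0)}\omega_{(\mathbf F_1,\mathbf F_0)}(\mathbf t)\;\mathbf F_1\mathbf v_1\otimes \mathbf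 F_0\mathbf v_0\in L ,$$ the sum being over all pairs of words in the letters $f_1,\dots,f_N$ in which each $f_i$ occurs exactly $k_i$ times in total. Here $\omega_{(\mathbf F_1,\mathbf F_0)}$ is the sum of the function $g_{(\mathbf F_1,\mathbf F_0)}$ over the permutations in $S_{k_1}\times\dots\times S_{k_N}$ of the variables, where $S_{k_i}$ permutes $t_1(i),\dots,t_{k_i}(i)$, and $g_{(\mathbf F_1,\mathbf F_0)}$ is defined as follows: in the concatenated word $\mathbf F_1\mathbf F_0$ replace, for each $i$, the $l$-th occurrence of $f_i$ from the left by $t_l(i)$; if $\mathbf F_1$ becomes $a_1\dots a_p$ and $\mathbf F_0$ becomes $b_1\dots b_q$, then $$g_{(\mathbf F_1,\mathbf F_0)}=\frac1{(a_1-a_2)\cdots(a_{p-1}-a_p)(a_p-1)}\cdot\frac1{(b_1-b_2)\cdots(b_{q-1}-b_q)\,b_q},$$ a factor belonging to an empty word being $1$. The Bethe system for $\mathbf k$ is, for $1\le i\le N$, $1\le l\le k_i$, $$\sum_{s\ne l}\frac{2}{t_l(i)-t_s(i)}-\sum_{|j-i|=1}\ \sum_{s=1}^{k_j}\frac1{t_l(i)-t_s(j)}-\frac{(\Lambda(0),\alpha_i)}{t_l(i)}-\frac{(\Lambda(1),\alpha_i)}{t_l(i)-1}=0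 .$$ A Bethe vector in $L$ is a vector $\mathbf v_{\mathbf k}(\mathbf t)$, where $\Lambda(\mathbf k)$ is the highest weight of an irreducible component of $L$ and $\mathbf t$ (as above) is a solution of the Bethe system for $\mathbf k$. **Corollary.** (1) If $\Lambda(0)=m\lambda_1$ for an integer $m\ge0$ (that is, $L_{\Lambda(0)}$ is the $m$-th symmetric power of the standard representation), $\mathbf k=(k_1,k_2,0,\dots,0)$, and $\Lambda(\mathbf k)=\Lambda(1)+\Lambda(0)-k_1\alpha_1-k_2\alpha_2$ is the highest weight of an irreducible component of $L$, then $\mathbf v_{\mathbf k}(\mathbf t)\neq0$ for all $\mathbf t$ as above. (2) If $N=2$ (so that $L_{\Lambda(1)},L_{\Lambda(0)}$ are $\mathfrak{sl}_3$-modules) and $\Lambda(0)=m\lambda_1$ or $\Lambda(1)=m\lambda_1$ for some integer $m\ge0$, then every Bethe vector in $L$ is non-zero. -/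

import Mathlib

open scoped TensorProduct

universe u v

noncomputable section

namespace Gaudin

/-- The Lie algebra `sl_{N+1}(ℂ)`. -/
abbrev SL (N : ℕ) := LieAlgebra.SpecialLinear.sl (Fin (N + 1)) ℂ

/-- The Chevalley generator `e_i = E_{i,i+1}` (with indices starting from `0`, so that the root
`α_i` of the literature is number `i - 1` here). -/
def chevE {N : ℕ} (i : Fin N) : SL N :=
  LieAlgebra.SpecialLinear.single i.castSucc i.succ i.castSucc_lt_succ.ne 1

/-- The Chevalley generator `f_i = E_{i+1,i}`. -/
def chevF {N : ℕ} (i : Fin N) : SL N :=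
  LieAlgebra.SpecialLinear.single i.succ i.castSucc i.castSucc_lt_succ.ne' 1

/-- The Chevalley generator `h_i = E_{i,i} - E_{i+1,i+1}`. -/
def chevH {N : ℕ} (i : Fin N) : SL N :=
  LieAlgebra.SpecialLinear.singleSubSingle i.castSucc i.succ 1

/-- An integral weight `Λ` of `sl_{N+1}`, given by the integers `Λ i = (Λ, α_i)`, that is, by the
values of `Λ` on the `h_i`. -/
abbrev Weight (N : ℕ) := Fin N → ℤ

/-- The weights `λ_1, …, λ_{N+1}` of the standard representation (numbered from `0`);
their sum is `0`. -/
def lam {N : ℕ} (j : Fin (N + 1)) : Weight N := fun i =>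
  (if i.castSucc = j then 1 else 0) - (if i.succ = j then 1 else 0)

/-- The simple roots `α_i = λ_i - λ_{i+1}`. -/
def simpleRoot {N : ℕ} (i : Fin N) : Weight N := lam i.castSucc - lam i.succ

/-- The weight `Λ(k) = Λ(1) + Λ(0) - ∑ k_i α_i`. -/
def bigLambda {N : ℕ} (Λ₁ Λ₀ : Weight N) (k : Fin N → ℕ) : Weight N :=
  Λ₁ + Λ₀ - ∑ i, k i • simpleRoot i

section Modules

variable {N : ℕ} {V : Type*} [AddCommGroup V] [Module ℂ V] [LieRingModule (SL N) V]

/-- `x` is a highest weight vector (a non-zero singular vector) of weight `Λ`. -/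
def IsHighestWeightVector (Λ : Weight N) (x : V) : Prop :=
  x ≠ 0 ∧ (∀ i : Fin N, ⁅(chevE i : SL N), x⁆ = 0) ∧
    ∀ i : Fin N, ⁅(chevH i : SL N), x⁆ = (Λ i : ℂ) • x

/-- `Λ` is the highest weight of an irreducible component of the module `V`. -/
def IsComponentHighestWeight (V : Type*) [AddCommGroup V] [Module ℂ V] [LieRingModule (SL N) V]
    [LieModule ℂ (SL N) V] (Λ : Weight N) : Prop :=
  ∃ W : LieSubmodule ℂ (SL N) V,
    LieModule.IsIrreducible ℂ (SL N) W ∧ ∃ w : W, IsHighestWeightVector Λ w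

/-- The action on `x` of a word `f_{i_1} … f_{i_s}` (the leftmost letter acts last). -/
def wordAct (F : List (Fin N)) (x : V) : V :=
  F.foldr (fun i y => ⁅(chevF i : SL N), y⁆) x

end Modules

/-- There are finitely many pairs of words with prescribed total numbers of letters. -/
theorem wordPairs_finite {N : ℕ} (k : Fin N → ℕ) :
    {p : List (Fin N) × List (Fin N) | ∀ i, (p.1 ++ p.2).count i = k i}.Finite := by
  have hfin : {l : List (Fin N) | l.length ≤ ∑ i, k i}.Finite := List.finite_length_le _ _
  refine (hfin.prod hfin).subset ?_
  rintro ⟨a, b⟩ h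
  have hlen : (a ++ b).length = ∑ i, k i := by
    rw [← Finset.sum_congr rfl fun i _ => h i]
    have := Multiset.sum_count_eq_card (s := Finset.univ) (m := ((a ++ b : List (Fin N)) :
      Multiset (Fin N))) (fun i _ => Finset.mem_univ i)
    simpa only [Multiset.coe_count, Multiset.coe_card] using this.symm
  rw [List.length_append] at hlen
  simp only [Set.mem_prod, Set.mem_ofPred_eq]
  omega

/-- The pairs of words `(F₁, F₀)` in the letters `f_1, …, f_N` in which `f_i` occurs exactly
`k_i` times in total. -/
def wordPairs {N : ℕ} (k : Fin N → ℕ) : Finset (List (Fin N) × List (Fin N)) :=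
  (wordPairs_finite k).toFinset

/-- The values of the variables `t_1(i), …, t_{k_i}(i)`, `i = 1, …, N`. -/
abbrev Vars {N : ℕ} (k : Fin N → ℕ) := (i : Fin N) → Fin (k i) → ℂ

/-- Replace, for every `i`, the first occurrence of the letter `f_i` in a word by `t_1(i)`, the
second one by `t_2(i)`, and so on. The value `0` serves only for words with more than `k_i`
letters `f_i`, which do not occur below. -/
def substVars {N : ℕ} {k : Fin N → ℕ} (t : Vars k) (w : List (Fin N)) : List ℂ :=
  w.mapIdx fun p i =>
    if h : (w.take p).count i < k i then t i ⟨(w.take p).count i, h⟩ else 0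

/-- The fraction `1 / ((a_1 - a_2) (a_2 - a_3) ⋯ (a_{s-1} - a_s) (a_s - z))`
(equal to `1` for the empty row). -/
def rowFraction (z : ℂ) : List ℂ → ℂ
  | [] => 1
  | [a] => 1 / (a - z)
  | a :: b :: l => 1 / (a - b) * rowFraction z (b :: l)

/-- The rational function `g_{(F₁,F₀)}(t)` for the points `z_1 = 1` and `z_0 = 0`. -/
def gFun {N : ℕ} {k : Fin N → ℕ} (p : List (Fin N) × List (Fin N)) (t : Vars k) : ℂ :=
  rowFraction 1 ((substVars t (p.1 ++ p.2)).take p.1.length) *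
    rowFraction 0 ((substVars t (p.1 ++ p.2)).drop p.1.length)

/-- The symmetrization of `g_{(F₁,F₀)}` over `S_{k_1} × ⋯ × S_{k_N}`. -/
def omegaFun {N : ℕ} {k : Fin N → ℕ} (p : List (Fin N) × List (Fin N)) (t : Vars k) : ℂ :=
  ∑ π : (i : Fin N) → Equiv.Perm (Fin (k i)), gFun p (fun i l => t i (π i l))

/-- The domain of the universal weight function: the `t_l(i)` are pairwise distinct, and different
from the points `0` and `1`. -/
def InDomain {N : ℕ} {k : Fin N → ℕ} (t : Vars k) : Prop :=
  Function.Injective (fun q : (i : Fin N) × Fin (k i) => t q.1 q.2) ∧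
    ∀ i l, t i l ≠ 0 ∧ t i l ≠ 1

/-- The Bethe system for the weights `Λ(1)`, `Λ(0)` at the points `z_1 = 1`, `z_0 = 0`
(the second sum runs over the roots `α_j` adjacent to `α_i`). -/
def BetheSystem {N : ℕ} (Λ₁ Λ₀ : Weight N) {k : Fin N → ℕ} (t : Vars k) : Prop :=
  ∀ (i : Fin N) (l : Fin (k i)),
    (∑ s ∈ Finset.univ.erase l, 2 / (t i l - t i s)) -
      (∑ j ∈ Finset.univ.filter (fun j : Fin N => (j : ℕ) + 1 = i ∨ (i : ℕ) + 1 = j),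
        ∑ s, 1 / (t i l - t j s)) -
      (Λ₀ i : ℂ) / t i l - (Λ₁ i : ℂ) / (t i l - 1) = 0

section Tensor

variable {N : ℕ} {V₁ V₀ : Type*}
  [AddCommGroup V₁] [Module ℂ V₁] [LieRingModule (SL N) V₁] [LieModule ℂ (SL N) V₁]
  [AddCommGroup V₀] [Module ℂ V₀] [LieRingModule (SL N) V₀] [LieModule ℂ (SL N) V₀]

/-- The universal weight function
`v_k(t) = ∑ ω_{(F₁,F₀)}(t) F₁ v₁ ⊗ F₀ v₀` with values in `V₁ ⊗ V₀`. -/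
def universalWeight (v₁ : V₁) (v₀ : V₀) {k : Fin N → ℕ} (t : Vars k) : V₁ ⊗[ℂ] V₀ :=
  ∑ p ∈ wordPairs k, omegaFun p t • (wordAct p.1 v₁ ⊗ₜ[ℂ] wordAct p.2 v₀)

/-- `x` is a Bethe vector in `V₁ ⊗ V₀` (the factors having highest weight vectors `v₁`, `v₀` of
weights `Λ₁`, `Λ₀`): the value of the universal weight function at a solution of the Bethe system
that belongs to a highest weight `Λ(k)` of an irreducible component of `V₁ ⊗ V₀`. -/
def IsBetheVector (Λ₁ Λ₀ : Weight N) (v₁ : V₁) (v₀ : V₀) (x : V₁ ⊗[ℂ] V₀) : Prop :=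
  ∃ (k : Fin N → ℕ) (t : Vars k),
    IsComponentHighestWeight (V₁ ⊗[ℂ] V₀) (bigLambda Λ₁ Λ₀ k) ∧
      InDomain t ∧ BetheSystem Λ₁ Λ₀ t ∧ x = universalWeight v₁ v₀ t

end Tensor

end Gaudin

end

/-! The vector is detected in a single weight component of the first tensor factor. The operator of
a coweight on that factor separates the summands F_1 v_1 ⊗ F_0 v_0, and the only pair of words whose
first word has weight -k_2 α_2 is (f_2^{k_2}, f_1^{k_1}). Its coefficient symmetrizes two row
fractions in disjoint sets of variables; by partial fractions it equals ∏ 1/(t_s(2) - 1) · ∏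
1/t_s(1), which is never zero (`omegaFun_replicate_ne_zero`). Hence it suffices that f_2^{k_2} v_1 ≠
0 and f_1^{k_1} v_0 ≠ 0 (`universalWeight_ne_zero`).

Both follow from the existence of a singular vector w of weight Λ(k)
(`wordAct_replicate_ne_zero_of_singular`). Let φ be the functional on the first factor with φ(v_1) =
1 that kills the images of all f_i. By irreducibility u = (φ ⊗ 1) w is non-zero, and its weight is
Λ(0) - k_1 α_1 - k_2 α_2. Since (Λ(0), α_2) = 0, f_2 kills v_0, and u is a multiple of f_1^{k_1 -
k_2} [f_2, f_1]^{k_2} v_0. This gives f_1^{k_1} v_0 ≠ 0 and e_2^{k_2} u ≠ 0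
(`IsHighestWeightVector.raise_ne_zero`). As w is singular, e_2^{k_2} u = ±(φ e_2^{k_2} ⊗ 1) w, so φ
e_2^{k_2} ≠ 0, and comparing weights yields f_2^{k_2} v_1 ≠ 0.

If Λ(1) = mλ_1 instead, the same argument applies to the flipped tensor product, with the pair
(f_1^{k_1}, f_2^{k_2}). -/

noncomputable section

set_option linter.unusedSectionVars false

namespace Gaudin

open LieAlgebra.SpecialLinear

/-! ### Relations between the Chevalley generators, and coweights. -/

section Relations

variable {N : ℕ}

theorem single_lie_single {a b c d : Fin (N + 1)} (hab : a ≠ b) (hcd : c ≠ d) (hda : d ≠ a)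
    (hbd : a ≠ d) (hbc : b = c) (r s : ℂ) :
    ⁅(single a b hab r : SL N), single c d hcd s⁆ = single a d hbd (r * s) := by
  subst hbc
  ext : 1
  rw [sl_bracket]
  simp [hda]

theorem single_lie_single_of_ne {a b c d : Fin (N + 1)} (hab : a ≠ b) (hcd : c ≠ d) (hda : d ≠ a)
    (hbc : b ≠ c) (r s : ℂ) :
    ⁅(single a b hab r : SL N), single c d hcd s⁆ = 0 := by
  ext : 1
  rw [sl_bracket]
  simp [hda, hbc]

theorem single_lie_single_swap {a b : Fin (N + 1)} (hab : a ≠ b) (r s : ℂ) :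
    ⁅(single a b hab r : SL N), single b a hab.symm s⁆ = singleSubSingle a b (r * s) := by
  ext : 1
  rw [sl_bracket]
  simp [mul_comm]

theorem singleSubSingle_lie_single {a b c d : Fin (N + 1)} (hcd : c ≠ d) :
    ⁅(singleSubSingle a b (1 : ℂ) : SL N), single c d hcd (1 : ℂ)⁆ =
      (((if a = c then 1 else 0) - (if b = c then 1 else 0)) -
        ((if a = d then 1 else 0) - (if b = d then 1 else 0)) : ℂ) • single c d hcd (1 : ℂ) := by
  ext : 1
  rw [sl_bracket]
  simp only [val_singleSubSingle, val_single, sub_mul, mul_sub]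
  have key (x : Fin (N + 1)) : Matrix.single x x (1 : ℂ) * Matrix.single c d 1 =
      (if x = c then 1 else 0 : ℂ) • Matrix.single c d 1 := by
    split_ifs with h <;> simp [h]
  have key' (x : Fin (N + 1)) : Matrix.single c d (1 : ℂ) * Matrix.single x x 1 =
      (if x = d then 1 else 0 : ℂ) • Matrix.single c d 1 := by
    split_ifs with h
    · simp [h]
    · simp [Ne.symm h]
  rw [key, key, key', key', ← sub_smul, ← sub_smul, ← sub_smul]
  rfl

theorem chevE_lie_chevF_self (i : Fin N) : ⁅(chevE i : SL N), chevF i⁆ = chevH i := by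
  exact (single_lie_single_swap (N := N) i.castSucc_lt_succ.ne 1 1).trans (by rw [mul_one]; rfl)

theorem chevE_lie_chevF_of_ne {i j : Fin N} (h : i ≠ j) : ⁅(chevE i : SL N), chevF j⁆ = 0 :=
  single_lie_single_of_ne _ _ (by simpa using h.symm) (by simpa using h) _ _

theorem chevH_lie_chevF (i j : Fin N) :
    ⁅(chevH i : SL N), chevF j⁆ = (-(simpleRoot j i : ℂ)) • (chevF j : SL N) := by
  rw [chevH, chevF, singleSubSingle_lie_single]
  congr 1
  simp only [simpleRoot, lam, Pi.sub_apply]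
  push_cast
  ring

theorem chevH_lie_chevE (i j : Fin N) :
    ⁅(chevH i : SL N), chevE j⁆ = (simpleRoot j i : ℂ) • (chevE j : SL N) := by
  rw [chevH, chevE, singleSubSingle_lie_single]
  congr 1
  simp only [simpleRoot, lam, Pi.sub_apply]
  push_cast
  ring

theorem serre_left {i j : Fin N} (h : (j : ℕ) = i + 1) :
    ⁅(⁅chevF j, chevF i⁆ : SL N), chevF i⁆ = 0 := by
  have e : i.succ = j.castSucc := by ext; simp [h]
  rw [chevF, chevF, single_lie_single (hbd := by simp [Fin.ext_iff, h]; omega) (hbc := e.symm)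
    (hda := by simp [Fin.ext_iff, h]; omega)]
  exact single_lie_single_of_ne _ _ (by simp [Fin.ext_iff, h]; omega)
    (by simp [Fin.ext_iff]) _ _

theorem serre_right {i j : Fin N} (h : (j : ℕ) = i + 1) :
    ⁅(⁅chevF j, chevF i⁆ : SL N), chevF j⁆ = 0 := by
  have e : i.succ = j.castSucc := by ext; simp [h]
  rw [chevF, chevF, single_lie_single (hbd := by simp [Fin.ext_iff, h]; omega) (hbc := e.symm)
    (hda := by simp [Fin.ext_iff, h]; omega)]
  exact single_lie_single_of_ne _ _ (by simp [Fin.ext_iff, h])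
    (by simp [Fin.ext_iff, h]; omega) _ _

theorem simpleRoot_succ {i j : Fin N} (h : (j : ℕ) = i + 1) : simpleRoot i j = -1 := by
  simp only [simpleRoot, lam, Pi.sub_apply, Fin.ext_iff, Fin.val_castSucc, Fin.val_succ, h]
  simp
  omega

/-- Coefficients of the fundamental coweight number `l` in the basis `h_i`. -/
theorem exists_coweight (l : Fin N) :
    ∃ q : Fin N → ℂ, ∀ j, ∑ i, q i * (simpleRoot j i : ℂ) = if j = l then 1 else 0 := by
  -- A column of the inverse Cartan matrix: piecewise linear, zero at 0 and N + 1, with slope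
  -- dropping by 1 at l + 1. Pairing with λ_a gives Q (a + 1) - Q a, so pairing with α_j gives the
  -- drop of slope at j + 1.
  let Q : ℕ → ℂ := fun n => (min n (l + 1) : ℕ) - (n : ℂ) * (l + 1) / (N + 1)
  have hN : (N + 1 : ℂ) ≠ 0 := by exact_mod_cast Nat.succ_ne_zero N
  have hlN := l.isLt
  have Q0 : Q 0 = 0 := by simp [Q]
  have QN : Q (N + 1) = 0 := by
    simp only [Q]
    rw [min_eq_right (by omega)]
    push_cast
    field_simp
    ring
  have hlam (a : Fin (N + 1)) :
      ∑ i : Fin N, Q (i + 1) * (lam a i : ℂ) = Q (a + 1) - Q a := by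
    have h1 : ∑ i : Fin N, Q (i + 1) * (if i.castSucc = a then 1 else 0) = Q (a + 1) := by
      have := Fin.sum_univ_castSucc (fun b : Fin (N + 1) => Q (b + 1) * (if b = a then 1 else 0))
      simpa [QN, eq_comm] using this.symm
    have h2 : ∑ i : Fin N, Q (i + 1) * (if i.succ = a then 1 else 0) = Q a := by
      have := Fin.sum_univ_succ (fun b : Fin (N + 1) => Q b * (if b = a then 1 else 0))
      simpa [Q0, eq_comm] using this.symm
    simp only [lam]
    push_cast
    simp only [mul_sub, Finset.sum_sub_distrib]
    rw [h1, h2]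
  refine ⟨fun i => Q (i + 1), fun j => ?_⟩
  simp only [simpleRoot, Pi.sub_apply]
  push_cast
  simp only [mul_sub, Finset.sum_sub_distrib]
  rw [hlam, hlam]
  simp only [Q, Fin.val_castSucc, Fin.val_succ]
  rcases lt_trichotomy (j : ℕ) l with h | h | h
  · rw [if_neg (fun e => h.ne (congrArg _ e)), min_eq_left (by omega), min_eq_left (by omega),
      min_eq_left (by omega)]
    push_cast
    ring
  · rw [if_pos (Fin.ext h), min_eq_left (by omega), min_eq_left (by omega),
      min_eq_right (by omega), h]
    push_cast
    ring
  · rw [if_neg (fun e => h.ne' (congrArg _ e)), min_eq_right (by omega), min_eq_right (by omega),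
      min_eq_right (by omega)]
    push_cast
    ring

/-- A Lie subalgebra containing the Chevalley generators is everything. -/
theorem lieSubalgebra_eq_top (K : LieSubalgebra ℂ (SL N)) (hE : ∀ i, chevE i ∈ K)
    (hF : ∀ i, chevF i ∈ K) : K = ⊤ := by
  -- Induction on the height n + 1 = b - a: E_{a,b} = [E_{a,b-1}, E_{b-1,b}], and likewise for the
  -- transposes.
  have up (n : ℕ) : ∀ (a b : Fin (N + 1)) (h : (b : ℕ) = a + n + 1) (r : ℂ),
      single a b (by intro e; subst e; omega) r ∈ K ∧
      single b a (by intro e; subst e; omega) r ∈ K := by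
    induction n with
    | zero =>
      intro a b h r
      have ha : (a : ℕ) < N := by omega
      obtain ⟨i, rfl⟩ : ∃ i : Fin N, a = i.castSucc := ⟨⟨a, ha⟩, rfl⟩
      obtain rfl : b = i.succ := by ext; simpa using h
      constructor
      · simpa [chevE, ← map_smul] using K.smul_mem r (hE i)
      · simpa [chevF, ← map_smul] using K.smul_mem r (hF i)
    | succ n ih =>
      intro a b h r
      have hc : (a : ℕ) + n + 1 < N + 1 := by omega
      let c : Fin (N + 1) := ⟨a + n + 1, hc⟩
      have hcN : (c : ℕ) < N := by simp only [c]; omega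
      obtain ⟨i, hi⟩ : ∃ i : Fin N, c = i.castSucc := ⟨⟨c, hcN⟩, rfl⟩
      have hci : (i : ℕ) = a + n + 1 := by
        have := congrArg Fin.val hi
        simpa [c] using this.symm
      obtain rfl : b = i.succ := by ext; simp; omega
      obtain ⟨h1, h2⟩ := ih a c rfl r
      constructor
      · have := K.lie_mem h1 (hE i)
        rw [chevE, single_lie_single (hbc := hi) (hda := by simp [Fin.ext_iff]; omega)
          (hbd := by simp [Fin.ext_iff]; omega)] at this
        simpa using this
      · have := K.lie_mem (hF i) h2
        rw [chevF, single_lie_single (hbc := hi.symm) (hda := by simp [Fin.ext_iff]; omega)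
          (hbd := by simp [Fin.ext_iff]; omega)] at this
        simpa using this
  have hsingle (a b : Fin (N + 1)) (h : a ≠ b) (r : ℂ) : single a b h r ∈ K := by
    rcases lt_or_gt_of_ne h with h' | h'
    · exact (up (b - a - 1) a b (by have : (a : ℕ) < b := h'; omega) r).1
    · exact (up (a - b - 1) b a (by have : (b : ℕ) < a := h'; omega) r).2
  have hdiag (a : Fin (N + 1)) (r : ℂ) : singleSubSingle a 0 r ∈ K := by
    by_cases h : a = 0
    · subst h
      have : (singleSubSingle 0 0 r : SL N) = 0 := by ext : 1; simp
      rw [this]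
      exact K.zero_mem
    · have := K.lie_mem (hsingle a 0 h r) (hsingle 0 a (Ne.symm h) 1)
      rwa [single_lie_single_swap, mul_one] at this
  rw [eq_top_iff]
  intro x _
  have hx : x = ∑ a, ∑ b, if h : a = b then singleSubSingle a 0 (x.val a a)
      else single a b h (x.val a b) := by
    have htr : ∑ a, x.val a a = 0 := x.property
    have h1 (a b : Fin (N + 1)) :
        ((if h : a = b then singleSubSingle a 0 (x.val a a)
          else single a b h (x.val a b) : SL N)).val =
        Matrix.single a b (x.val a b) -
          if a = b then Matrix.single 0 0 (x.val a a) else 0 := by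
      split_ifs with h
      · subst h; simp
      · simp
    ext : 1
    rw [AddSubmonoidClass.coe_finsetSum]
    simp_rw [AddSubmonoidClass.coe_finsetSum, h1, Finset.sum_sub_distrib]
    rw [← Matrix.matrix_eq_sum_single]
    simp only [Finset.sum_ite_eq, Finset.mem_univ, if_true]
    have : ∑ a, Matrix.single (0 : Fin (N + 1)) (0 : Fin (N + 1)) (x.val a a) = 0 := by
      have := map_sum (Matrix.singleLinearMap ℂ (0 : Fin (N + 1)) (0 : Fin (N + 1)))
        (fun a => x.val a a) Finset.univ
      rw [htr, map_zero] at this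
      exact this.symm
    rw [this, sub_zero]
  rw [hx]
  refine sum_mem fun a _ => sum_mem fun b _ => ?_
  split_ifs with h
  · exact hdiag a _
  · exact hsingle a b h _

end Relations

/-! ### Separation of eigenvalues. -/

section Eigen

variable {M : Type*} [AddCommGroup M] [Module ℂ M]

/-- An eigenvector in the span of a family of eigenvectors is in the span of those members of the
family that have the same eigenvalue. -/
theorem mem_span_image_of_eigenvector {ι : Type*} (T : Module.End ℂ M) (x : ι → M) (ev : ι → ℂ)
    (P : Set ι) (hx : ∀ p ∈ P, T (x p) = ev p • x p) {u : M}
    (hu : u ∈ Submodule.span ℂ (x '' P)) {μ : ℂ} (hT : T u = μ • u) :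
    u ∈ Submodule.span ℂ (x '' {p ∈ P | ev p = μ}) := by
  have hP : P = {p ∈ P | ev p = μ} ∪ {p ∈ P | ev p ≠ μ} := by
    ext p; by_cases h : ev p = μ <;> simp [h]
  rw [hP, Set.image_union, Submodule.span_union, Submodule.mem_sup] at hu
  obtain ⟨a, ha, b, hb, rfl⟩ := hu
  have ha' : a ∈ T.eigenspace μ := by
    refine (Submodule.span_le.2 ?_ : _ ≤ T.eigenspace μ) ha
    rintro _ ⟨p, ⟨hp, rfl⟩, rfl⟩
    exact Module.End.mem_eigenspace_iff.2 (hx p hp)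
  have hb' : b ∈ ⨆ ν, ⨆ (_ : ν ≠ μ), T.eigenspace ν := by
    refine (Submodule.span_le.2 ?_ : _ ≤ ⨆ ν, ⨆ (_ : ν ≠ μ), T.eigenspace ν) hb
    rintro _ ⟨p, ⟨hp, hne⟩, rfl⟩
    exact Submodule.mem_iSup_of_mem (ev p)
      (Submodule.mem_iSup_of_mem hne (Module.End.mem_eigenspace_iff.2 (hx p hp)))
  -- Being a difference of two `μ`-eigenvectors, `b` also lies in the `μ`-eigenspace, which is
  -- independent of the others.
  have hb'' : b ∈ T.eigenspace μ := by
    have := Submodule.sub_mem _ (Module.End.mem_eigenspace_iff.2 hT) ha'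
    simpa using this
  have : b = 0 := (Submodule.disjoint_def.1 (T.eigenspaces_iSupIndep μ)) b hb'' hb'
  simpa [this] using ha

end Eigen

/-! ### Irreducible highest weight modules and the dual highest weight functional. -/

section Modules

variable {N : ℕ} {V : Type*} [AddCommGroup V] [Module ℂ V] [LieRingModule (SL N) V]
  [LieModule ℂ (SL N) V]

theorem lie_mem_of_chev (S : Submodule ℂ V) (hE : ∀ i : Fin N, ∀ x ∈ S, ⁅(chevE i : SL N), x⁆ ∈ S)
    (hF : ∀ i : Fin N, ∀ x ∈ S, ⁅(chevF i : SL N), x⁆ ∈ S) (y : SL N) {x : V} (hx : x ∈ S) :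
    ⁅y, x⁆ ∈ S := by
  let K : LieSubalgebra ℂ (SL N) :=
    { carrier := {y | ∀ x ∈ S, ⁅y, x⁆ ∈ S}
      add_mem' := fun ha hb x hx => by
        rw [add_lie]; exact S.add_mem (ha x hx) (hb x hx)
      zero_mem' := fun x _ => by rw [zero_lie]; exact S.zero_mem
      smul_mem' := fun c a ha x hx => by
        rw [smul_lie]; exact S.smul_mem c (ha x hx)
      lie_mem' := fun {a b} ha hb x hx => by
        rw [lie_lie]; exact S.sub_mem (ha _ (hb x hx)) (hb _ (ha x hx)) }
  have : y ∈ K := by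
    rw [lieSubalgebra_eq_top K hE hF]
    trivial
  exact this x hx

theorem submodule_eq_top [LieModule.IsIrreducible ℂ (SL N) V] (S : Submodule ℂ V)
    (hE : ∀ i : Fin N, ∀ x ∈ S, ⁅(chevE i : SL N), x⁆ ∈ S)
    (hF : ∀ i : Fin N, ∀ x ∈ S, ⁅(chevF i : SL N), x⁆ ∈ S) (hS : S ≠ ⊥) : S = ⊤ := by
  let W : LieSubmodule ℂ (SL N) V :=
    { S with lie_mem := fun {y x} hx => lie_mem_of_chev S hE hF y hx }
  have hW : (W : Submodule ℂ V) = S := rfl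
  rcases eq_bot_or_eq_top W with h | h
  · exact absurd (by rw [← hW, h]; rfl) hS
  · rw [← hW, h]; rfl

theorem lie_chevE_chevF (i j : Fin N) (x : V) :
    ⁅(chevE i : SL N), ⁅(chevF j : SL N), x⁆⁆ =
      ⁅(chevF j : SL N), ⁅(chevE i : SL N), x⁆⁆ +
        if i = j then ⁅(chevH i : SL N), x⁆ else 0 := by
  rw [leibniz_lie, add_comm]
  split_ifs with h
  · subst h
    rw [chevE_lie_chevF_self]
  · rw [chevE_lie_chevF_of_ne h, zero_lie]

@[simp]
theorem wordAct_nil (x : V) : wordAct ([] : List (Fin N)) x = x := rfl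

@[simp]
theorem wordAct_cons (i : Fin N) (F : List (Fin N)) (x : V) :
    wordAct (i :: F) x = ⁅(chevF i : SL N), wordAct F x⁆ := rfl

theorem lie_wordAct {H : SL N} {a : Fin N → ℂ}
    (hH : ∀ j, ⁅H, (chevF j : SL N)⁆ = (-a j) • (chevF j : SL N)) {c : ℂ} {x : V}
    (hx : ⁅H, x⁆ = c • x) (F : List (Fin N)) :
    ⁅H, wordAct F x⁆ = (c - (F.map a).sum) • wordAct F x := by
  induction F with
  | nil => simpa using hx
  | cons i F ih =>
    rw [wordAct_cons, leibniz_lie, hH, ih, smul_lie, lie_smul, ← add_smul]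
    congr 1
    simp
    ring

/-- The action of a word `e_{i_1} … e_{i_s}`. -/
def raise (V : Type*) [AddCommGroup V] [Module ℂ V] [LieRingModule (SL N) V]
    [LieModule ℂ (SL N) V] (E : List (Fin N)) : Module.End ℂ V :=
  (E.map fun i => LieModule.toEnd ℂ (SL N) V (chevE i)).prod

@[simp]
theorem raise_nil : raise V ([] : List (Fin N)) = 1 := rfl

@[simp]
theorem raise_cons (i : Fin N) (E : List (Fin N)) (x : V) :
    raise V (i :: E) x = ⁅(chevE i : SL N), raise V E x⁆ := by
  simp [raise]

@[simp]
theorem raise_append (E E' : List (Fin N)) (x : V) :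
    raise V (E ++ E') x = raise V E (raise V E' x) := by
  simp [raise]

theorem lie_raise {H : SL N} {a : Fin N → ℂ}
    (hH : ∀ j, ⁅H, (chevE j : SL N)⁆ = a j • (chevE j : SL N)) (x : V) (E : List (Fin N)) :
    ⁅H, raise V E x⁆ = raise V E ⁅H, x⁆ + (E.map a).sum • raise V E x := by
  induction E with
  | nil => simp
  | cons i E ih =>
    rw [raise_cons, leibniz_lie, hH, ih, smul_lie, lie_add, lie_smul, raise_cons, List.map_cons,
      List.sum_cons, add_smul]
    abel

/-- The fundamental coweight number `l`. -/
def coweight (l : Fin N) : SL N := ∑ i, (exists_coweight l).choose i • chevH i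

/-- The value of a weight on the fundamental coweight number `l`. -/
def pairing (l : Fin N) (μ : Weight N) : ℂ := ∑ i, (exists_coweight l).choose i * (μ i : ℂ)

theorem pairing_simpleRoot (l j : Fin N) : pairing l (simpleRoot j) = if j = l then 1 else 0 :=
  (exists_coweight l).choose_spec j

theorem pairing_add (l : Fin N) (μ ν : Weight N) :
    pairing l (μ + ν) = pairing l μ + pairing l ν := by
  simp [pairing, mul_add, Finset.sum_add_distrib]

theorem pairing_sub_sum (l : Fin N) (μ : Weight N) (k : Fin N → ℕ) :
    pairing l (μ - ∑ i, k i • simpleRoot i) = pairing l μ - k l := by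
  have h : pairing l (∑ i, k i • simpleRoot i) = k l := by
    have : pairing l (∑ i, k i • simpleRoot i) = ∑ i, (k i : ℂ) * pairing l (simpleRoot i) := by
      simp only [pairing, Finset.sum_apply, nsmul_eq_mul, Finset.mul_sum]
      push_cast
      simp only [Finset.mul_sum]
      rw [Finset.sum_comm]
      exact Finset.sum_congr rfl fun i _ => Finset.sum_congr rfl fun j _ => by simp; ring
    rw [this]
    simp [pairing_simpleRoot]
  have := pairing_add l (μ - ∑ i, k i • simpleRoot i) (∑ i, k i • simpleRoot i)
  rw [sub_add_cancel, h] at this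
  rw [this, add_sub_cancel_right]

theorem coweight_lie {l : Fin N} {μ : Weight N} {x : V}
    (h : ∀ i, ⁅(chevH i : SL N), x⁆ = (μ i : ℂ) • x) :
    ⁅(coweight l : SL N), x⁆ = pairing l μ • x := by
  rw [coweight, pairing, sum_lie, Finset.sum_smul]
  refine Finset.sum_congr rfl fun i _ => ?_
  rw [smul_lie, h, mul_smul]

theorem coweight_lie_chevF (l j : Fin N) :
    ⁅(coweight l : SL N), chevF j⁆ = (-(if j = l then 1 else 0 : ℂ)) • (chevF j : SL N) := by
  rw [← pairing_simpleRoot, coweight, pairing, sum_lie, ← Finset.sum_neg_distrib,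
    Finset.sum_smul]
  refine Finset.sum_congr rfl fun i _ => ?_
  rw [smul_lie, chevH_lie_chevF, ← mul_smul, mul_neg]

theorem coweight_lie_chevE (l j : Fin N) :
    ⁅(coweight l : SL N), chevE j⁆ = (if j = l then 1 else 0 : ℂ) • (chevE j : SL N) := by
  rw [← pairing_simpleRoot]
  exact coweight_lie (fun i => chevH_lie_chevE i j)

theorem sum_map_ite_eq_count (l : Fin N) (F : List (Fin N)) :
    (F.map fun j => (if j = l then 1 else 0 : ℂ)).sum = F.count l := by
  induction F with
  | nil => simp
  | cons i F ih =>
    rw [List.map_cons, List.sum_cons, ih, List.count_cons]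
    by_cases h : i = l <;> simp [h, add_comm]

theorem coweight_wordAct {l : Fin N} {c : ℂ} {x : V} (hx : ⁅(coweight l : SL N), x⁆ = c • x)
    (F : List (Fin N)) :
    ⁅(coweight l : SL N), wordAct F x⁆ = (c - F.count l) • wordAct F x := by
  rw [lie_wordAct (coweight_lie_chevF l) hx, sum_map_ite_eq_count]

variable {Λ : Weight N} {v : V}

theorem IsHighestWeightVector.coweight_wordAct (hv : IsHighestWeightVector Λ v) (l : Fin N)
    (F : List (Fin N)) :
    ⁅(coweight l : SL N), wordAct F v⁆ = (pairing l Λ - F.count l) • wordAct F v :=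
  Gaudin.coweight_wordAct (coweight_lie hv.2.2) F

variable [LieModule.IsIrreducible ℂ (SL N) V]

/-- Moving e_i to the right through a word leaves only shorter words scaled by weights, so the span
is stable under all e_i and f_i. -/
theorem IsHighestWeightVector.span_wordAct (hv : IsHighestWeightVector Λ v) :
    Submodule.span ℂ (Set.range fun F : List (Fin N) => wordAct F v) = ⊤ := by
  set S := Submodule.span ℂ (Set.range fun F : List (Fin N) => wordAct F v) with hS
  have hmem (F : List (Fin N)) : wordAct F v ∈ S := Submodule.subset_span ⟨F, rfl⟩
  have ind (y : SL N) (h : ∀ F : List (Fin N), ⁅y, wordAct F v⁆ ∈ S) : ∀ x ∈ S, ⁅y, x⁆ ∈ S := by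
    intro x hx
    have : S ≤ S.comap (LieModule.toEnd ℂ (SL N) V y : V →ₗ[ℂ] V) := by
      rw [hS, Submodule.span_le, ← hS]
      rintro _ ⟨F, rfl⟩
      exact h F
    exact this hx
  have hF (i : Fin N) : ∀ x ∈ S, ⁅(chevF i : SL N), x⁆ ∈ S :=
    ind _ fun F => hmem (i :: F)
  refine submodule_eq_top S (fun i => ind _ fun F => ?_) hF fun h => hv.1 ?_
  · induction F with
    | nil => simp [hv.2.1 i]
    | cons j F ih =>
      rw [wordAct_cons, lie_chevE_chevF]
      refine S.add_mem (hF j _ ih) ?_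
      split_ifs
      · rw [lie_wordAct (chevH_lie_chevF i) (hv.2.2 i)]
        exact S.smul_mem _ (hmem F)
      · exact S.zero_mem
  · have := hmem []
    rwa [h, Submodule.mem_bot] at this

/-- The sum of all coweights grades words by length, so `v` is not a combination of non-empty words.
A functional separating it from them kills every f_i V, because words span V. -/
theorem IsHighestWeightVector.exists_functional (hv : IsHighestWeightVector Λ v) :
    ∃ φ : V →ₗ[ℂ] ℂ, φ v = 1 ∧ ∀ (i : Fin N) (x : V), φ ⁅(chevF i : SL N), x⁆ = 0 := by
  let w : List (Fin N) → V := fun F => wordAct F v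
  have hnot : v ∉ Submodule.span ℂ (w '' {F | F ≠ []}) := by
    intro hmem
    have hFl (F : List (Fin N)) : ∑ l, (F.count l : ℂ) = F.length := by
      have := Multiset.sum_count_eq_card (s := Finset.univ) (m := ((F : List (Fin N)) :
        Multiset (Fin N))) (fun i _ => Finset.mem_univ i)
      simp only [Multiset.coe_count, Multiset.coe_card] at this
      exact_mod_cast this
    have hw (F : List (Fin N)) : LieModule.toEnd ℂ (SL N) V (∑ l, coweight l) (w F) =
        (∑ l, pairing l Λ - F.length) • w F := by
      rw [LieModule.toEnd_apply_apply, sum_lie]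
      simp only [w, hv.coweight_wordAct]
      rw [← Finset.sum_smul, Finset.sum_sub_distrib, hFl]
    have := mem_span_image_of_eigenvector _ w _ _ (fun F _ => hw F) hmem (hw [])
    have hempty : {F ∈ {F : List (Fin N) | F ≠ []} | ∑ l, pairing l Λ - (F.length : ℂ) =
        ∑ l, pairing l Λ - (([] : List (Fin N)).length : ℂ)} = ∅ := by
      ext F
      simp
    rw [hempty, Set.image_empty, Submodule.span_empty, Submodule.mem_bot] at this
    exact hv.1 this
  obtain ⟨φ, hφv, hφ⟩ := Submodule.exists_le_ker_of_notMem hnot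
  refine ⟨(φ v)⁻¹ • φ, by simp [hφv], fun i x => ?_⟩
  have hx : x ∈ Submodule.span ℂ (Set.range w) := by rw [hv.span_wordAct]; trivial
  have hle : Submodule.span ℂ (Set.range w) ≤
      LinearMap.ker (φ ∘ₗ LieModule.toEnd ℂ (SL N) V (chevF i)) := by
    rw [Submodule.span_le]
    rintro _ ⟨F, rfl⟩
    exact hφ (Submodule.subset_span ⟨i :: F, by simp, rfl⟩)
  have : φ ⁅(chevF i : SL N), x⁆ = 0 := hle hx
  simp [this]

variable {φ : V →ₗ[ℂ] ℂ}

theorem IsHighestWeightVector.functional_lie (hv : IsHighestWeightVector Λ v)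
    (hφ : ∀ (i : Fin N) (x : V), φ ⁅(chevF i : SL N), x⁆ = 0) {H : SL N} {a : Fin N → ℂ}
    (hH : ∀ j, ⁅H, (chevF j : SL N)⁆ = (-a j) • (chevF j : SL N)) {c : ℂ} (hx : ⁅H, v⁆ = c • v)
    (x : V) : φ ⁅H, x⁆ = c * φ x := by
  have h : x ∈ Submodule.span ℂ (Set.range fun F : List (Fin N) => wordAct F v) := by
    rw [hv.span_wordAct]; trivial
  have hle : Submodule.span ℂ (Set.range fun F : List (Fin N) => wordAct F v) ≤
      LinearMap.ker (φ ∘ₗ LieModule.toEnd ℂ (SL N) V H - c • φ) := by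
    rw [Submodule.span_le]
    rintro _ ⟨F, rfl⟩
    cases F with
    | nil => simp [hx]
    | cons i F => simp [leibniz_lie H, hH, hφ]
  have := hle h
  simpa [sub_eq_zero] using this

/-- Non-degeneracy of the pairing between words in the e_i and vectors: its kernel is a submodule
not containing `v`, hence zero by irreducibility. -/
theorem IsHighestWeightVector.eq_zero_of_functional (hv : IsHighestWeightVector Λ v)
    (hφv : φ v = 1) (hφ : ∀ (i : Fin N) (x : V), φ ⁅(chevF i : SL N), x⁆ = 0) {x : V}
    (hx : ∀ E : List (Fin N), φ (raise V E x) = 0) : x = 0 := by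
  let S : Submodule ℂ V := ⨅ E : List (Fin N), LinearMap.ker (φ ∘ₗ raise V E)
  have hmem (y : V) : y ∈ S ↔ ∀ E : List (Fin N), φ (raise V E y) = 0 := by
    simp [S, Submodule.mem_iInf]
  have hE (i : Fin N) (y : V) (hy : y ∈ S) : ⁅(chevE i : SL N), y⁆ ∈ S := by
    rw [hmem] at hy ⊢
    intro E
    simpa using hy (E ++ [i])
  have hH (i : Fin N) (y : V) (hy : y ∈ S) : ⁅(chevH i : SL N), y⁆ ∈ S := by
    rw [hmem] at hy ⊢
    intro E
    have h1 := lie_raise (chevH_lie_chevE i) y E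
    have h2 := congrArg φ h1
    rw [hv.functional_lie hφ (chevH_lie_chevF i) (hv.2.2 i), hy, map_add, map_smul, hy] at h2
    simpa using h2.symm
  have hF (i : Fin N) (y : V) (hy : y ∈ S) : ⁅(chevF i : SL N), y⁆ ∈ S := by
    rw [hmem]
    intro E
    induction E using List.reverseRecOn generalizing y with
    | nil => simpa using hφ i y
    | append_singleton E j ih =>
      have : raise V [j] ⁅(chevF i : SL N), y⁆ = ⁅(chevE j : SL N), ⁅(chevF i : SL N), y⁆⁆ := by
        simp
      rw [raise_append, this, lie_chevE_chevF, map_add, map_add, ih _ (hE j y hy), zero_add]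
      split_ifs
      · exact (hmem _).1 (hH j y hy) E
      · simp
  by_contra hne
  have htop := submodule_eq_top S hE hF fun h => hne <| by
    have := (hmem x).2 hx
    rwa [h, Submodule.mem_bot] at this
  have hvS : v ∈ S := by rw [htop]; trivial
  have := (hmem v).1 hvS []
  simp [hφv] at this

theorem IsHighestWeightVector.chevF_eq_zero (hv : IsHighestWeightVector Λ v) {i : Fin N}
    (hi : Λ i = 0) : ⁅(chevF i : SL N), v⁆ = 0 := by
  obtain ⟨φ, hφv, hφ⟩ := hv.exists_functional
  refine hv.eq_zero_of_functional hφv hφ fun E => ?_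
  rcases List.eq_nil_or_concat E with rfl | ⟨E, j, rfl⟩
  · simpa using hφ i v
  · have : raise V [j] ⁅(chevF i : SL N), v⁆ = ⁅(chevE j : SL N), ⁅(chevF i : SL N), v⁆⁆ := by
      simp
    rw [List.concat_eq_append, raise_append, this, lie_chevE_chevF, hv.2.1, hv.2.2]
    split_ifs with h
    · simp [h, hi]
    · simp

/-- A vector of weight `Λ - ∑ k_i α_i` is a combination of the words with `k_i` letters `f_i`. -/
theorem IsHighestWeightVector.mem_span_wordAct (hv : IsHighestWeightVector Λ v) (k : Fin N → ℕ)
    {u : V} (hu : ∀ l, ⁅(coweight l : SL N), u⁆ = (pairing l Λ - k l) • u) :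
    u ∈ Submodule.span ℂ ((fun F : List (Fin N) => wordAct F v) '' {F | ∀ l, F.count l = k l}) := by
  -- The letter counts are pinned down one at a time, by the eigenvalue of the corresponding
  -- coweight.
  have key (s : Finset (Fin N)) : u ∈ Submodule.span ℂ
      ((fun F : List (Fin N) => wordAct F v) '' {F | ∀ l ∈ s, F.count l = k l}) := by
    induction s using Finset.induction_on with
    | empty =>
      have : u ∈ (⊤ : Submodule ℂ V) := trivial
      rw [← hv.span_wordAct] at this
      simpa using this
    | insert l s _ ih =>
      have := mem_span_image_of_eigenvector (LieModule.toEnd ℂ (SL N) V (coweight l)) _ _ _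
        (fun F _ => hv.coweight_wordAct l F) ih (hu l)
      refine Submodule.span_mono (Set.image_mono ?_) this
      rintro F ⟨h1, h2⟩ j hj
      rcases Finset.mem_insert.1 hj with rfl | hj
      · exact_mod_cast sub_right_injective h2
      · exact h1 j hj
  simpa using key Finset.univ

end Modules

/-! ### Operator identities modelled on symmetric powers. -/

section SymmetricPower

variable {M : Type*} [AddCommGroup M] [Module ℂ M] {A B C E : Module.End ℂ M} {v : M}

/-- Here A = f_1, B = f_2, C = [f_2, f_1], E = e_2. In Sym^m the vector A^a C^b v is proportional to
x_1^{m-a-b} x_2^a x_3^b; B turns an x_2 into x_3 and E does the reverse. -/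
theorem apply_pow_pow_of_lower (hBA : B * A = A * B + C) (hCA : Commute C A) (hCB : Commute C B)
    (hv : B v = 0) (a b : ℕ) :
    B ((A ^ (a + 1) * C ^ b) v) = (a + 1 : ℂ) • (A ^ a * C ^ (b + 1)) v := by
  have hBA' (x : M) : B (A x) = A (B x) + C x := by
    simpa using congrArg (fun T : Module.End ℂ M => T x) hBA
  have hBC : B ((C ^ b) v) = 0 := by
    have := congrArg (fun T : Module.End ℂ M => T v) ((hCB.pow_left b).eq)
    simp only [Module.End.mul_apply] at this
    rw [← this, hv, map_zero]
  have hC (n : ℕ) : C ((A ^ n * C ^ b) v) = (A ^ n * C ^ (b + 1)) v := by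
    rw [← Module.End.mul_apply, ← mul_assoc, (hCA.pow_right n).eq, mul_assoc, ← pow_succ']
  induction a with
  | zero =>
    have := hC 0
    simp only [pow_zero, one_mul] at this
    simp [hBA', hBC, this]
  | succ a ih =>
    rw [pow_succ', mul_assoc, Module.End.mul_apply, hBA', ih, hC, map_smul, ← Module.End.mul_apply,
      ← mul_assoc, ← pow_succ']
    push_cast
    module

theorem apply_pow_pow_of_lower_zero (hCB : Commute C B) (hv : B v = 0) (b : ℕ) :
    B ((C ^ b) v) = 0 := by
  rw [← Module.End.mul_apply, ← (hCB.pow_left b).eq, Module.End.mul_apply, hv, map_zero]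

theorem apply_pow_pow_of_raise (hEC : E * C = C * E + A) (hEA : Commute E A) (hCA : Commute C A)
    (hv : E v = 0) (a b : ℕ) :
    E ((A ^ a * C ^ (b + 1)) v) = (b + 1 : ℂ) • (A ^ (a + 1) * C ^ b) v := by
  have hEC' (x : M) : E (C x) = C (E x) + A x := by
    simpa using congrArg (fun T : Module.End ℂ M => T x) hEC
  have key : E ((C ^ (b + 1)) v) = (b + 1 : ℂ) • (A * C ^ b) v := by
    induction b with
    | zero => simp [hEC', hv]
    | succ b ih =>
      rw [pow_succ', Module.End.mul_apply, hEC', ih, map_smul, ← Module.End.mul_apply, ← mul_assoc,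
        hCA.eq, mul_assoc, ← pow_succ', ← Module.End.mul_apply]
      push_cast
      module
  rw [← Module.End.mul_apply, ← mul_assoc, (hEA.pow_right a).eq, mul_assoc, Module.End.mul_apply,
    Module.End.mul_apply, key, map_smul, ← Module.End.mul_apply, ← mul_assoc, ← pow_succ]

theorem pow_apply_pow_pow_of_raise (hEC : E * C = C * E + A) (hEA : Commute E A)
    (hCA : Commute C A) (hv : E v = 0) (a b : ℕ) :
    (E ^ b) ((A ^ a * C ^ b) v) = (b.factorial : ℂ) • (A ^ (a + b)) v := by
  induction b generalizing a with
  | zero => simp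
  | succ b ih =>
    rw [pow_succ E, Module.End.mul_apply, apply_pow_pow_of_raise hEC hEA hCA hv, map_smul, ih,
      smul_smul, Nat.factorial_succ, add_assoc, add_comm 1 b]
    push_cast
    rfl

/-- B sends A^{a+1} C^b v to a non-zero multiple of A^a C^{b+1} v, so vanishing of the former forces
vanishing of the latter. -/
theorem pow_apply_ne_zero_of_pow_pow (hBA : B * A = A * B + C) (hCA : Commute C A)
    (hCB : Commute C B) (hv : B v = 0) (a b : ℕ) (h : (A ^ a * C ^ b) v ≠ 0) :
    (A ^ (a + b)) v ≠ 0 := by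
  induction b generalizing a with
  | zero => simpa using h
  | succ b ih =>
    have := ih (a + 1) fun h0 => h ?_
    · rwa [add_assoc, add_comm 1 b] at this
    · have := apply_pow_pow_of_lower hBA hCA hCB hv a b
      rw [h0, map_zero] at this
      exact (smul_eq_zero.1 this.symm).resolve_left (by exact_mod_cast Nat.succ_ne_zero a)

end SymmetricPower

/-! ### Weight vectors of a module with highest weight orthogonal to α_j. -/

section Module

variable {N : ℕ} {M : Type*} [AddCommGroup M] [Module ℂ M] [LieRingModule (SL N) M]
  [LieModule ℂ (SL N) M]

theorem wordAct_replicate (n : ℕ) (i : Fin N) (x : M) :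
    wordAct (List.replicate n i) x = ((LieModule.toEnd ℂ (SL N) M (chevF i)) ^ n) x := by
  induction n with
  | zero => simp
  | succ n ih => rw [List.replicate_succ, wordAct_cons, ih, pow_succ']; rfl

theorem raise_replicate (n : ℕ) (i : Fin N) (x : M) :
    raise M (List.replicate n i) x = ((LieModule.toEnd ℂ (SL N) M (chevE i)) ^ n) x := by
  simp [raise]

variable [LieModule.IsIrreducible ℂ (SL N) M] {Λ : Weight N} {v : M}

/-- Non-zero weight vectors of weight `Λ - k_i α_i - k_j α_j` when `(Λ, α_j) = 0`. -/
theorem IsHighestWeightVector.raise_ne_zero (hv : IsHighestWeightVector Λ v) {i j : Fin N}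
    (hij : (j : ℕ) = i + 1) (hΛ : Λ j = 0) (k : Fin N → ℕ) (hk : ∀ l, l ≠ i → l ≠ j → k l = 0)
    {u : M} (hu0 : u ≠ 0) (hu : ∀ l, ⁅(coweight l : SL N), u⁆ = (pairing l Λ - k l) • u) :
    raise M (List.replicate (k j) j) u ≠ 0 ∧ wordAct (List.replicate (k i) i) v ≠ 0 := by
  have hne : i ≠ j := by rintro rfl; omega
  set A := LieModule.toEnd ℂ (SL N) M (chevF i) with hA
  set B := LieModule.toEnd ℂ (SL N) M (chevF j) with hB
  set C := LieModule.toEnd ℂ (SL N) M ⁅(chevF j : SL N), chevF i⁆ with hC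
  set E := LieModule.toEnd ℂ (SL N) M (chevE j) with hE
  have hT (a b : SL N) : LieModule.toEnd ℂ (SL N) M a * LieModule.toEnd ℂ (SL N) M b =
      LieModule.toEnd ℂ (SL N) M b * LieModule.toEnd ℂ (SL N) M a +
        LieModule.toEnd ℂ (SL N) M ⁅a, b⁆ := by
    ext x
    simp
  have hBA : B * A = A * B + C := hT _ _
  have hCA : Commute C A := (hT _ _).trans (by rw [serre_left hij, map_zero, add_zero])
  have hCB : Commute C B := (hT _ _).trans (by rw [serre_right hij, map_zero, add_zero])
  have hEA : Commute E A :=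
    (hT _ _).trans (by rw [chevE_lie_chevF_of_ne hne.symm, map_zero, add_zero])
  have hEC : E * C = C * E + A := (hT _ _).trans <| by
    rw [leibniz_lie, chevE_lie_chevF_self, chevE_lie_chevF_of_ne hne.symm, lie_zero, add_zero,
      chevH_lie_chevF, simpleRoot_succ hij]
    simp [hC, hE, hA]
  have hBv : B v = 0 := hv.chevF_eq_zero hΛ
  have hEv : E v = 0 := hv.2.1 j
  -- Every word collapses to one monomial A^a C^b; the counts need not match when the scalar is
  -- zero, as when B meets C^b v.
  have hword (F : List (Fin N)) (hF : ∀ l ∈ F, l = i ∨ l = j) :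
      ∃ (c : ℂ) (a b : ℕ), wordAct F v = c • (A ^ a * C ^ b) v ∧
        (c = 0 ∨ (F.count i = a + b ∧ F.count j = b)) := by
    induction F with
    | nil => exact ⟨1, 0, 0, by simp, by simp⟩
    | cons l F ih =>
      obtain ⟨c, a, b, h1, h2⟩ := ih fun l hl => hF l (List.mem_cons_of_mem _ hl)
      rcases hF l List.mem_cons_self with rfl | rfl
      · refine ⟨c, a + 1, b, ?_, h2.imp_right ?_⟩
        · rw [wordAct_cons, h1, lie_smul, pow_succ', mul_assoc]
          rfl
        · rintro ⟨h3, h4⟩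
          rw [List.count_cons_self, List.count_cons_of_ne hne, h3]
          exact ⟨by omega, h4⟩
      · cases a with
        | zero =>
          refine ⟨0, 0, 0, ?_, Or.inl rfl⟩
          rw [wordAct_cons, h1, lie_smul, zero_smul, pow_zero, one_mul]
          exact smul_eq_zero_of_right _ (apply_pow_pow_of_lower_zero hCB hBv b)
        | succ a =>
          refine ⟨c * (a + 1), a, b + 1, ?_, ?_⟩
          · rw [wordAct_cons, h1, lie_smul, mul_smul,
              ← apply_pow_pow_of_lower hBA hCA hCB hBv a b]
            rfl
          · rcases h2 with rfl | ⟨h3, h4⟩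
            · simp
            · right
              rw [List.count_cons_self, List.count_cons_of_ne hne.symm, h3, h4]
              omega
  -- The last clause guarantees that the natural subtraction k i - k j is not truncated for non-zero
  -- `u`.
  have hspan : ∃ c : ℂ, u = c • (A ^ (k i - k j) * C ^ (k j)) v ∧ (u ≠ 0 → k j ≤ k i) := by
    have := hv.mem_span_wordAct k hu
    clear hu0 hu
    induction this using Submodule.span_induction with
    | mem x hx =>
      obtain ⟨F, hF, rfl⟩ := hx
      obtain ⟨c, a, b, h1, h2⟩ := hword F fun l hl => by
        by_contra! h
        have := hk l h.1 h.2
        rw [← hF l, List.count_eq_zero] at this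
        exact this hl
      refine ⟨c, ?_⟩
      rcases h2 with rfl | ⟨h3, h4⟩
      · simp [h1]
      · rw [hF] at h3 h4
        rw [h3, h4, Nat.add_sub_cancel]
        exact ⟨h1, by simp⟩
    | zero => exact ⟨0, by simp⟩
    | add x y _ _ hx hy =>
      obtain ⟨c, hx, hx'⟩ := hx
      obtain ⟨d, hy, hy'⟩ := hy
      refine ⟨c + d, by rw [add_smul, ← hx, ← hy], fun h => ?_⟩
      by_cases h0 : x = 0
      · exact hy' (by simpa [h0] using h)
      · exact hx' h0
    | smul r x _ hx =>
      obtain ⟨c, hx, hx'⟩ := hx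
      exact ⟨r * c, by rw [mul_smul, ← hx], fun h => hx' (right_ne_zero_of_smul h)⟩
  obtain ⟨c, rfl, hle⟩ := hspan
  have hle := hle hu0
  have hc : c ≠ 0 := left_ne_zero_of_smul hu0
  have hy := right_ne_zero_of_smul hu0
  have hA' := pow_apply_ne_zero_of_pow_pow hBA hCA hCB hBv _ _ hy
  rw [Nat.sub_add_cancel hle] at hA'
  refine ⟨?_, by rwa [wordAct_replicate]⟩
  rw [raise_replicate, map_smul, pow_apply_pow_pow_of_raise hEC hEA hCA hEv,
    Nat.sub_add_cancel hle]
  exact smul_ne_zero hc (smul_ne_zero (by exact_mod_cast Nat.factorial_ne_zero _) hA')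

end Module

/-! ### Contraction of a singular vector with functionals. -/

section Contraction

variable {N : ℕ} {V M : Type*} [AddCommGroup V] [Module ℂ V] [LieRingModule (SL N) V]
  [LieModule ℂ (SL N) V] [AddCommGroup M] [Module ℂ M] [LieRingModule (SL N) M]
  [LieModule ℂ (SL N) M]

/-- Contraction of the first tensor factor with a linear functional. -/
def contract (M : Type*) [AddCommGroup M] [Module ℂ M] (ψ : V →ₗ[ℂ] ℂ) : V ⊗[ℂ] M →ₗ[ℂ] M :=
  TensorProduct.lid ℂ M ∘ₗ LinearMap.rTensor M ψ

@[simp]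
theorem contract_tmul (ψ : V →ₗ[ℂ] ℂ) (x : V) (y : M) : contract M ψ (x ⊗ₜ y) = ψ x • y := by
  simp [contract]

theorem contract_smul (c : ℂ) (ψ : V →ₗ[ℂ] ℂ) (w : V ⊗[ℂ] M) :
    contract M (c • ψ) w = c • contract M ψ w := by
  simp [contract, LinearMap.rTensor_smul]

theorem contract_lie (ψ : V →ₗ[ℂ] ℂ) (y : SL N) (w : V ⊗[ℂ] M) :
    contract M ψ ⁅y, w⁆ =
      contract M (ψ ∘ₗ LieModule.toEnd ℂ (SL N) V y) w + ⁅y, contract M ψ w⁆ := by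
  induction w using TensorProduct.induction_on with
  | zero => simp
  | tmul a b => simp [TensorProduct.LieModule.lie_tmul_right]
  | add a b ha hb =>
    rw [lie_add, map_add, ha, hb, map_add, map_add, lie_add]
    abel

theorem eq_zero_of_forall_functional (w : V ⊗[ℂ] M)
    (h : ∀ χ : M →ₗ[ℂ] ℂ, TensorProduct.rid ℂ V (LinearMap.lTensor V χ w) = 0) : w = 0 := by
  classical
  let b := Module.Basis.ofVectorSpace ℂ M
  apply (TensorProduct.equivFinsuppOfBasisRight (M := V) b).injective
  ext i
  rw [map_zero, Finsupp.zero_apply, ← h (b.coord i)]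
  clear h
  induction w using TensorProduct.induction_on with
  | zero => simp
  | tmul x y => simp
  | add x y hx hy => simp only [map_add, Finsupp.add_apply, hx, hy]

theorem functional_contract (ψ : V →ₗ[ℂ] ℂ) (χ : M →ₗ[ℂ] ℂ) (w : V ⊗[ℂ] M) :
    χ (contract M ψ w) = ψ (TensorProduct.rid ℂ V (LinearMap.lTensor V χ w)) := by
  induction w using TensorProduct.induction_on with
  | zero => simp
  | tmul x y => simp [mul_comm]
  | add x y hx hy => simp only [map_add, hx, hy]

/-- Since e_i w = 0, applying e_i in the first factor is minus applying it in the second; the order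
of letters is reversed. -/
theorem contract_comp_raise {w : V ⊗[ℂ] M} (hw : ∀ i : Fin N, ⁅(chevE i : SL N), w⁆ = 0)
    (ψ : V →ₗ[ℂ] ℂ) (E : List (Fin N)) :
    contract M (ψ ∘ₗ raise V E) w = (-1 : ℂ) ^ E.length • raise M E.reverse (contract M ψ w) := by
  induction E generalizing ψ with
  | nil => simp; rfl
  | cons i E ih =>
    have h1 : ψ ∘ₗ raise V (i :: E) =
        (ψ ∘ₗ LieModule.toEnd ℂ (SL N) V (chevE i)) ∘ₗ raise V E := by
      ext x; simp
    have h2 := contract_lie ψ (chevE i) w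
    rw [hw, map_zero] at h2
    rw [h1, ih, eq_neg_of_add_eq_zero_left h2.symm, List.reverse_cons, raise_append, map_neg,
      List.length_cons, pow_succ]
    simp

theorem lie_comm (y : SL N) (w : V ⊗[ℂ] M) :
    ⁅y, TensorProduct.comm ℂ V M w⁆ = TensorProduct.comm ℂ V M ⁅y, w⁆ := by
  induction w using TensorProduct.induction_on with
  | zero => simp
  | tmul a b => simp [TensorProduct.LieModule.lie_tmul_right, add_comm]
  | add a b ha hb => simp only [map_add, lie_add, ha, hb]

variable [LieModule.IsIrreducible ℂ (SL N) V] [LieModule.IsIrreducible ℂ (SL N) M]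
  {Λ Λ' : Weight N} {v : V} {v' : M}

/-- Words span, so φ e_j^n is non-zero on some word applied to `v`. Since φ is a weight functional,
that word has the letters of f_j^n, and so equals it. -/
theorem IsHighestWeightVector.wordAct_replicate_ne_zero (hv : IsHighestWeightVector Λ v) {φ : V →ₗ[ℂ] ℂ}
    (hφ : ∀ (i : Fin N) (x : V), φ ⁅(chevF i : SL N), x⁆ = 0) {n : ℕ} {j : Fin N}
    (h : φ ∘ₗ raise V (List.replicate n j) ≠ 0) : wordAct (List.replicate n j) v ≠ 0 := by
  obtain ⟨F, hF⟩ : ∃ F : List (Fin N), φ (raise V (List.replicate n j) (wordAct F v)) ≠ 0 := by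
    by_contra! h0
    refine h (LinearMap.ker_eq_top.1 (top_le_iff.1 ?_))
    rw [← hv.span_wordAct, Submodule.span_le]
    rintro _ ⟨F, rfl⟩
    exact h0 F
  have hcount (l : Fin N) : F.count l = (List.replicate n j).count l := by
    have h1 := congrArg φ (lie_raise (coweight_lie_chevE l) (wordAct F v) (List.replicate n j))
    rw [hv.functional_lie hφ (coweight_lie_chevF l) (coweight_lie hv.2.2), hv.coweight_wordAct,
      map_smul, map_add, map_smul, map_smul, smul_eq_mul, smul_eq_mul, ← add_mul] at h1
    have h2 := mul_right_cancel₀ hF h1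
    rw [sum_map_ite_eq_count] at h2
    have h3 : (F.count l : ℂ) = (List.replicate n j).count l := by linear_combination h2
    exact_mod_cast h3
  have : F = List.replicate n j := by
    refine List.eq_replicate_iff.2 ⟨(List.perm_iff_count.2 hcount).length_eq.trans (by simp), ?_⟩
    intro l hl
    exact List.eq_of_mem_replicate ((List.perm_iff_count.2 hcount).mem_iff.1 hl)
  rw [← this]
  intro h0
  simp [h0] at hF

/-- The consequence of Pieri's rule for a tensor product whose second factor has a highest weight
orthogonal to the root `α_j`. -/
theorem wordAct_replicate_ne_zero_of_singular (hv : IsHighestWeightVector Λ v)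
    (hv' : IsHighestWeightVector Λ' v') {i j : Fin N} (hij : (j : ℕ) = i + 1) (hΛ : Λ' j = 0)
    (k : Fin N → ℕ) (hk : ∀ l, l ≠ i → l ≠ j → k l = 0) {w : V ⊗[ℂ] M}
    (hw : IsHighestWeightVector (bigLambda Λ Λ' k) w) :
    wordAct (List.replicate (k j) j) v ≠ 0 ∧ wordAct (List.replicate (k i) i) v' ≠ 0 := by
  obtain ⟨φ, hφv, hφ⟩ := hv.exists_functional
  -- If (φ ⊗ 1) w = 0, then (φE ⊗ 1) w = 0 for every word E in the e_i, so non-degeneracy kills each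
  -- (1 ⊗ χ) w.
  have hu0 : contract M φ w ≠ 0 := by
    intro h0
    refine hw.1 (eq_zero_of_forall_functional w fun χ =>
      hv.eq_zero_of_functional hφv hφ fun E => ?_)
    have := functional_contract (φ ∘ₗ raise V E) χ w
    rw [contract_comp_raise hw.2.1, h0, map_zero, smul_zero, map_zero] at this
    exact this.symm
  have hu (l : Fin N) : ⁅(coweight l : SL N), contract M φ w⁆ =
      (pairing l Λ' - k l) • contract M φ w := by
    have h1 := contract_lie φ (coweight l) w
    have h2 : φ ∘ₗ LieModule.toEnd ℂ (SL N) V (coweight l) = pairing l Λ • φ := by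
      ext x
      exact hv.functional_lie hφ (coweight_lie_chevF l) (coweight_lie hv.2.2) x
    rw [coweight_lie hw.2.2, h2, contract_smul, bigLambda, pairing_sub_sum, pairing_add,
      map_smul] at h1
    rw [← sub_eq_iff_eq_add'] at h1
    rw [← h1]
    module
  obtain ⟨h1, h2⟩ := hv'.raise_ne_zero hij hΛ k hk hu0 hu
  refine ⟨hv.wordAct_replicate_ne_zero hφ fun h0 => h1 ?_, h2⟩
  have h3 := contract_comp_raise hw.2.1 φ (List.replicate (k j) j)
  rw [h0, List.reverse_replicate] at h3
  have h4 : contract M (0 : V →ₗ[ℂ] ℂ) w = 0 := by simp [contract]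
  rw [h4] at h3
  exact (smul_eq_zero.1 h3.symm).resolve_left (pow_ne_zero _ (by norm_num))

end Contraction

/-! ### Symmetrized row fractions. -/

section Symmetrization

theorem rowFraction_append_singleton (z a : ℂ) (l : List ℂ) :
    rowFraction z (l ++ [a]) = rowFraction a l * (1 / (a - z)) := by
  induction l with
  | nil => simp [rowFraction]
  | cons b l ih =>
    cases l with
    | nil => simp [rowFraction]
    | cons c l =>
      simp only [List.cons_append, rowFraction] at ih ⊢
      rw [ih, mul_assoc]

/-- Lagrange interpolation of the constant 1 at the nodes -t_i, evaluated at -z; the negation makes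
the signs agree. -/
theorem sum_prod_inv_sub {n : ℕ} (hn : n ≠ 0) (z : ℂ) (t : Fin n → ℂ)
    (ht : Function.Injective t) (hz : ∀ i, t i ≠ z) :
    ∑ p, 1 / (t p - z) * ∏ j ∈ Finset.univ.erase p, 1 / (t j - t p) = ∏ i, 1 / (t i - z) := by
  have hne : (Finset.univ : Finset (Fin n)).Nonempty := ⟨⟨0, Nat.pos_of_ne_zero hn⟩, by simp⟩
  have h1 := Lagrange.eval_interpolate_not_at_node (s := Finset.univ) (v := fun i => -t i) (x := -z)
    1 (fun i _ h => hz i (neg_injective h).symm)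
  rw [Lagrange.interpolate_one (fun a _ b _ h => ht (neg_injective h)) hne, Polynomial.eval_one,
    Lagrange.eval_nodal] at h1
  have h2 : ∏ i, (-z - -t i) = ∏ i, (t i - z) := Finset.prod_congr rfl fun i _ => by ring
  have h3 : ∏ i, (t i - z) ≠ 0 := Finset.prod_ne_zero_iff.2 fun i _ => sub_ne_zero.2 (hz i)
  rw [h2] at h1
  rw [Finset.prod_div_distrib, Finset.prod_const_one, eq_div_iff h3, mul_comm]
  refine Eq.trans ?_ h1.symm
  congr 1
  refine Finset.sum_congr rfl fun p _ => ?_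
  rw [Lagrange.nodalWeight, Pi.one_apply, mul_one, mul_comm]
  congr 1
  · refine Finset.prod_congr rfl fun j _ => ?_
    rw [one_div]
    congr 1
    ring
  · rw [one_div]
    congr 1
    ring

/-- The variable t_p next to z is fixed; the remaining sum is the same one with z replaced by t_p,
and partial fractions sum over p. The row is reversed because `Equiv.Perm.decomposeFin` splits off
the image of 0. -/
theorem sum_perm_rowFraction_reverse {n : ℕ} (z : ℂ) (t : Fin n → ℂ)
    (ht : Function.Injective t) (hz : ∀ i, t i ≠ z) :
    ∑ π : Equiv.Perm (Fin n), rowFraction z (List.ofFn fun i => t (π i)).reverse =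
      ∏ i, 1 / (t i - z) := by
  induction n generalizing z with
  | zero => simp [rowFraction]
  | succ n ih =>
    rw [← sum_prod_inv_sub n.succ_ne_zero z t ht hz,
      ← Equiv.sum_comp Equiv.Perm.decomposeFin.symm, Fintype.sum_prod_type]
    refine Finset.sum_congr rfl fun p _ => ?_
    have hp (i : Fin n) : Equiv.swap 0 p i.succ ≠ p := fun h => by
      rw [← Equiv.eq_symm_apply, Equiv.symm_swap, Equiv.swap_apply_right] at h
      exact Fin.succ_ne_zero i h
    have h1 := ih (t p) (fun i => t (Equiv.swap 0 p i.succ))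
      (fun a b h => Fin.succ_injective _ ((Equiv.swap 0 p).injective (ht h)))
      (fun i h => hp i (ht h))
    have h2 : ∏ j ∈ Finset.univ.erase p, 1 / (t j - t p) =
        ∏ i : Fin n, 1 / (t (Equiv.swap 0 p i.succ) - t p) := by
      have := Equiv.prod_comp (Equiv.swap 0 p) fun j => if j = p then 1 else 1 / (t j - t p)
      rw [Fin.prod_univ_succ, Equiv.swap_apply_left, if_pos rfl, one_mul,
        ← Finset.mul_prod_erase _ _ (Finset.mem_univ p), if_pos rfl, one_mul] at this
      rw [Finset.prod_congr rfl fun i _ => if_neg (hp i)] at this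
      rw [this]
      exact Finset.prod_congr rfl fun j hj => (if_neg (Finset.ne_of_mem_erase hj)).symm
    rw [h2, ← h1, Finset.mul_sum]
    refine Finset.sum_congr rfl fun e _ => ?_
    rw [List.ofFn_succ, List.reverse_cons, rowFraction_append_singleton, mul_comm]
    simp

theorem sum_perm_rowFraction {n : ℕ} (z : ℂ) (t : Fin n → ℂ)
    (ht : Function.Injective t) (hz : ∀ i, t i ≠ z) :
    ∑ π : Equiv.Perm (Fin n), rowFraction z (List.ofFn fun i => t (π i)) =
      ∏ i, 1 / (t i - z) := by
  rw [← sum_perm_rowFraction_reverse z t ht hz, ← Equiv.sum_comp (Equiv.mulRight Fin.revPerm)]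
  refine Finset.sum_congr rfl fun π _ => ?_
  congr 1
  apply List.ext_getElem
  · simp
  · intro m h1 h2
    simp only [List.length_ofFn] at h1
    simp [List.getElem_reverse, Fin.rev]
    congr 3
    omega

end Symmetrization

/-! ### The coefficient of the distinguished pair of words. -/

section WeightFunction

variable {N : ℕ} {k : Fin N → ℕ} {i j : Fin N}

theorem substVars_replicate_append (hij : i ≠ j) (t : Vars k) :
    substVars t (List.replicate (k i) i ++ List.replicate (k j) j) =
      List.ofFn (t i) ++ List.ofFn (t j) := by
  have ht {a b : Fin N} (h : a = b) {n : ℕ} (ha : n < k a) (hb : n < k b) :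
      t a ⟨n, ha⟩ = t b ⟨n, hb⟩ := by subst h; rfl
  apply List.ext_getElem
  · simp [substVars]
  · intro m h1 h2
    simp only [List.length_append, List.length_ofFn] at h2
    simp only [substVars, List.getElem_mapIdx, List.getElem_append, List.length_replicate,
      List.length_ofFn, List.getElem_ofFn, List.getElem_replicate]
    by_cases h : m < k i
    · have hc : ((List.replicate (k i) i ++ List.replicate (k j) j).take m).count i = m := by
        rw [List.take_append_of_le_length (by simp; omega), List.take_replicate,
          List.count_replicate_self]
        omega
      simp only [h, dite_true, hc]
      exact ht (by simp [h]) _ _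
    · have hc : ((List.replicate (k i) i ++ List.replicate (k j) j).take m).count j =
          m - k i := by
        rw [List.take_append, List.take_replicate, List.take_replicate, List.count_append,
          List.count_replicate_self, List.count_replicate, if_neg (by simpa using hij),
          List.length_replicate]
        omega
      have h3 : m - k i < k j := by omega
      simp only [h, dite_false, hc, h3, dite_true]
      exact ht (by simp [List.getElem_append, h]) _ _

theorem gFun_replicate (hij : i ≠ j) (hk : ∀ l, l ≠ i → l ≠ j → k l = 0) (t : Vars k) :
    gFun (List.replicate (k i) i, List.replicate (k j) j) t =
      ∏ l, rowFraction (if l = i then 1 else 0) (List.ofFn (t l)) := by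
  rw [gFun]
  simp only [substVars_replicate_append hij, List.length_replicate]
  rw [List.take_left' (by simp), List.drop_left' (by simp),
    Finset.prod_eq_mul i j hij _ (by simp) (by simp), if_pos rfl, if_neg hij.symm]
  rintro l - ⟨h1, h2⟩
  have : List.ofFn (t l) = [] := by simp [hk l h1 h2]
  rw [this, rowFraction]

/-- Each letter has its own row, so the sum over the product of symmetric groups factors; letters
other than i and j give empty rows. -/
theorem omegaFun_replicate_ne_zero (hij : i ≠ j) (hk : ∀ l, l ≠ i → l ≠ j → k l = 0) {t : Vars k}
    (ht : InDomain t) : omegaFun (List.replicate (k i) i, List.replicate (k j) j) t ≠ 0 := by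
  have hz (l : Fin N) (s : Fin (k l)) : t l s ≠ if l = i then 1 else 0 := by
    split_ifs
    · exact (ht.2 l s).2
    · exact (ht.2 l s).1
  have hinj (l : Fin N) : Function.Injective (t l) := fun a b h => by
    simpa using @ht.1 ⟨l, a⟩ ⟨l, b⟩ h
  have : omegaFun (List.replicate (k i) i, List.replicate (k j) j) t =
      ∏ l, ∏ s, 1 / (t l s - if l = i then 1 else 0) := by
    rw [omegaFun]
    simp only [gFun_replicate hij hk]
    rw [Finset.prod_congr rfl fun l _ => (sum_perm_rowFraction _ (t l) (hinj l) (hz l)).symm,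
      Finset.prod_univ_sum, Fintype.piFinset_univ]
  rw [this]
  exact Finset.prod_ne_zero_iff.2 fun l _ => Finset.prod_ne_zero_iff.2 fun s _ =>
    one_div_ne_zero (sub_ne_zero.2 (hz l s))

/-- As `p.1.count i ≤ k i`, the equation forces all letters i and no letter j into the first word.
-/
theorem eq_replicate_of_mem_wordPairs (hij : i ≠ j) (hk : ∀ l, l ≠ i → l ≠ j → k l = 0)
    {p : List (Fin N) × List (Fin N)} (hp : p ∈ wordPairs k)
    (h : k i + p.1.count j = p.1.count i) :
    p = (List.replicate (k i) i, List.replicate (k j) j) := by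
  have hc (l : Fin N) : p.1.count l + p.2.count l = k l := by
    have : ∀ l, (p.1 ++ p.2).count l = k l := by simpa [wordPairs] using hp
    rw [← List.count_append, this]
  have key (F : List (Fin N)) (a b : Fin N) (ha : F.count a = k a)
      (h0 : ∀ l, l ≠ a → F.count l = 0) : F = List.replicate (k a) a := by
    have hF : ∀ l ∈ F, l = a := fun l hl => by
      by_contra hne
      exact List.count_eq_zero.1 (h0 l hne) hl
    rw [← ha, List.count_eq_length.2 fun l hl => (hF l hl).symm]
    exact List.eq_replicate_length.2 hF
  have hi := hc i
  have hj := hc j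
  refine Prod.ext (key _ i j (by omega) fun l hl => ?_) (key _ j i (by omega) fun l hl => ?_)
  · by_cases hlj : l = j
    · subst hlj; omega
    · have := hc l
      rw [hk l hl hlj] at this
      omega
  · by_cases hli : l = i
    · subst hli; omega
    · have := hc l
      rw [hk l hli hl] at this
      omega

end WeightFunction

/-! ### Non-vanishing of the universal weight function. -/

section Tensor

variable {N : ℕ} {V₁ V₀ : Type*}
  [AddCommGroup V₁] [Module ℂ V₁] [LieRingModule (SL N) V₁] [LieModule ℂ (SL N) V₁]
  [AddCommGroup V₀] [Module ℂ V₀] [LieRingModule (SL N) V₀] [LieModule ℂ (SL N) V₀]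
  {Λ₁ Λ₀ : Weight N} {v₁ : V₁} {v₀ : V₀} {i j : Fin N} {k : Fin N → ℕ}

theorem universalWeight_ne_zero (hv₁ : IsHighestWeightVector Λ₁ v₁) (hij : i ≠ j)
    (hk : ∀ l, l ≠ i → l ≠ j → k l = 0) (h₁ : wordAct (List.replicate (k i) i) v₁ ≠ 0)
    (h₀ : wordAct (List.replicate (k j) j) v₀ ≠ 0) {t : Vars k} (ht : InDomain t) :
    universalWeight v₁ v₀ t ≠ 0 := by
  intro h
  let x : List (Fin N) × List (Fin N) → V₁ ⊗[ℂ] V₀ := fun p => wordAct p.1 v₁ ⊗ₜ wordAct p.2 v₀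
  let p₀ : List (Fin N) × List (Fin N) := (List.replicate (k i) i, List.replicate (k j) j)
  -- The eigenvalue of T records count i minus count j in the first word. Its maximal count
  -- difference k_i is attained only at `p₀`, so one operator isolates that summand.
  let T : Module.End ℂ (V₁ ⊗[ℂ] V₀) :=
    LinearMap.rTensor V₀ (LieModule.toEnd ℂ (SL N) V₁ (coweight i - coweight j))
  have hT (p : List (Fin N) × List (Fin N)) : T (x p) =
      (pairing i Λ₁ - p.1.count i - (pairing j Λ₁ - p.1.count j)) • x p := by
    simp only [T, x, LinearMap.rTensor_tmul, LieModule.toEnd_apply_apply, sub_lie,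
      hv₁.coweight_wordAct]
    rw [← sub_smul, TensorProduct.smul_tmul']
  have hp₀ : p₀ ∈ wordPairs k := by
    simp only [wordPairs, Set.Finite.mem_toFinset, Set.mem_ofPred_eq, p₀, List.count_append,
      List.count_replicate]
    intro l
    by_cases hi : l = i
    · subst hi; simp [hij.symm]
    · by_cases hj : l = j
      · subst hj; simp [hij]
      · simp [hk l hi hj, Ne.symm hi, Ne.symm hj]
  have hmem : x p₀ ∈ Submodule.span ℂ (x '' {p | p ∈ wordPairs k ∧ p ≠ p₀}) := by
    rw [universalWeight, ← Finset.add_sum_erase _ _ hp₀] at h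
    have h2 : omegaFun p₀ t • x p₀ ∈ Submodule.span ℂ (x '' {p | p ∈ wordPairs k ∧ p ≠ p₀}) := by
      rw [eq_neg_of_add_eq_zero_left h]
      refine Submodule.neg_mem _ (Submodule.sum_mem _ fun p hp => Submodule.smul_mem _ _
        (Submodule.subset_span ⟨p, ?_, rfl⟩))
      exact ⟨Finset.mem_of_mem_erase hp, Finset.ne_of_mem_erase hp⟩
    exact (Submodule.smul_mem_iff _ (omegaFun_replicate_ne_zero hij hk ht)).1 h2
  have := mem_span_image_of_eigenvector T x _ _ (fun p _ => hT p) hmem (hT p₀)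
  rw [Set.eq_empty_of_forall_notMem (s := {p ∈ _ | _}), Set.image_empty, Submodule.span_empty,
    Submodule.mem_bot] at this
  · obtain ⟨ψ, hψ⟩ : ∃ ψ : V₁ →ₗ[ℂ] ℂ, ψ (wordAct (List.replicate (k i) i) v₁) ≠ 0 := by
      by_contra! h0
      exact h₁ ((Module.forall_dual_apply_eq_zero_iff ℂ _).1 h0)
    have h2 := congrArg (contract V₀ ψ) this
    rw [map_zero, contract_tmul] at h2
    exact smul_ne_zero hψ h₀ h2
  · rintro p ⟨⟨hp, hne⟩, he⟩
    refine hne (eq_replicate_of_mem_wordPairs hij hk hp ?_)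
    have h1 : (p₀.1.count i : ℂ) = k i := by simp [p₀]
    have h2 : (p₀.1.count j : ℂ) = 0 := by simp [p₀, List.count_replicate, hij]
    rw [h1, h2] at he
    have : (k i + p.1.count j : ℂ) = p.1.count i := by linear_combination he
    exact_mod_cast this

end Tensor

/-! ### Singular vectors of components, and the flip. -/

section Component

variable {N : ℕ} {V M : Type*} [AddCommGroup V] [Module ℂ V] [LieRingModule (SL N) V]
  [LieModule ℂ (SL N) V] [AddCommGroup M] [Module ℂ M] [LieRingModule (SL N) M]
  [LieModule ℂ (SL N) M] {Λ : Weight N}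

theorem IsComponentHighestWeight.exists_isHighestWeightVector
    (h : IsComponentHighestWeight V Λ) : ∃ w : V, IsHighestWeightVector Λ w := by
  obtain ⟨W, -, w, h0, hE, hH⟩ := h
  exact ⟨w, by simpa using h0, fun i => by simpa using congrArg Subtype.val (hE i),
    fun i => by simpa using congrArg Subtype.val (hH i)⟩

theorem IsHighestWeightVector.comm {w : V ⊗[ℂ] M} (hw : IsHighestWeightVector Λ w) :
    IsHighestWeightVector Λ (TensorProduct.comm ℂ V M w) :=
  ⟨by simpa using hw.1, fun i => by rw [lie_comm, hw.2.1, map_zero],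
    fun i => by rw [lie_comm, hw.2.2, map_smul]⟩

end Component

end Gaudin

end

theorem mainTheorem5 :
    (∀ (N : ℕ) (_ : 2 ≤ N) (V₁ : Type u) (V₀ : Type v)
      [AddCommGroup V₁] [Module ℂ V₁] [LieRingModule (Gaudin.SL N) V₁]
      [LieModule ℂ (Gaudin.SL N) V₁] [FiniteDimensional ℂ V₁]
      [LieModule.IsIrreducible ℂ (Gaudin.SL N) V₁]
      [AddCommGroup V₀] [Module ℂ V₀] [LieRingModule (Gaudin.SL N) V₀]
      [LieModule ℂ (Gaudin.SL N) V₀] [FiniteDimensional ℂ V₀]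
      [LieModule.IsIrreducible ℂ (Gaudin.SL N) V₀]
      (Λ₁ Λ₀ : Gaudin.Weight N) (v₁ : V₁) (v₀ : V₀)
      (_ : Gaudin.IsHighestWeightVector Λ₁ v₁) (_ : Gaudin.IsHighestWeightVector Λ₀ v₀)
      (m : ℕ) (_ : Λ₀ = m • Gaudin.lam 0)
      (k : Fin N → ℕ) (_ : ∀ i : Fin N, 2 ≤ (i : ℕ) → k i = 0)
      (_ : Gaudin.IsComponentHighestWeight (V₁ ⊗[ℂ] V₀) (Gaudin.bigLambda Λ₁ Λ₀ k))
      (t : Gaudin.Vars k) (_ : Gaudin.InDomain t),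
      Gaudin.universalWeight v₁ v₀ t ≠ 0) ∧
    (∀ (V₁ : Type u) (V₀ : Type v)
      [AddCommGroup V₁] [Module ℂ V₁] [LieRingModule (Gaudin.SL 2) V₁]
      [LieModule ℂ (Gaudin.SL 2) V₁] [FiniteDimensional ℂ V₁]
      [LieModule.IsIrreducible ℂ (Gaudin.SL 2) V₁]
      [AddCommGroup V₀] [Module ℂ V₀] [LieRingModule (Gaudin.SL 2) V₀]
      [LieModule ℂ (Gaudin.SL 2) V₀] [FiniteDimensional ℂ V₀]
      [LieModule.IsIrreducible ℂ (Gaudin.SL 2) V₀]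
      (Λ₁ Λ₀ : Gaudin.Weight 2) (v₁ : V₁) (v₀ : V₀)
      (_ : Gaudin.IsHighestWeightVector Λ₁ v₁) (_ : Gaudin.IsHighestWeightVector Λ₀ v₀)
      (_ : ∃ m : ℕ, Λ₀ = m • Gaudin.lam 0 ∨ Λ₁ = m • Gaudin.lam 0)
      (x : V₁ ⊗[ℂ] V₀) (_ : Gaudin.IsBetheVector Λ₁ Λ₀ v₁ v₀ x),
      x ≠ 0) := by
  have nonvanishing (N : ℕ) (hN : 2 ≤ N) (V₁ : Type u) (V₀ : Type v)
      [AddCommGroup V₁] [Module ℂ V₁] [LieRingModule (Gaudin.SL N) V₁]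
      [LieModule ℂ (Gaudin.SL N) V₁] [LieModule.IsIrreducible ℂ (Gaudin.SL N) V₁]
      [AddCommGroup V₀] [Module ℂ V₀] [LieRingModule (Gaudin.SL N) V₀]
      [LieModule ℂ (Gaudin.SL N) V₀] [LieModule.IsIrreducible ℂ (Gaudin.SL N) V₀]
      (Λ₁ Λ₀ : Gaudin.Weight N) (v₁ : V₁) (v₀ : V₀)
      (hv₁ : Gaudin.IsHighestWeightVector Λ₁ v₁) (hv₀ : Gaudin.IsHighestWeightVector Λ₀ v₀)
      (m : ℕ) (hΛ : Λ₀ = m • Gaudin.lam 0)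
      (k : Fin N → ℕ) (hk : ∀ i : Fin N, 2 ≤ (i : ℕ) → k i = 0)
      (hc : Gaudin.IsComponentHighestWeight (V₁ ⊗[ℂ] V₀) (Gaudin.bigLambda Λ₁ Λ₀ k))
      (t : Gaudin.Vars k) (ht : Gaudin.InDomain t) :
      Gaudin.universalWeight v₁ v₀ t ≠ 0 := by
    -- Here i and j stand for α_1 and α_2; they are passed to `universalWeight_ne_zero` in swapped
    -- roles, since f_2 acts on the first factor.
    let i : Fin N := ⟨0, by omega⟩
    let j : Fin N := ⟨1, by omega⟩
    have hji : j ≠ i := by simp [i, j]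
    have hk' (l : Fin N) (h1 : l ≠ j) (h2 : l ≠ i) : k l = 0 := hk l <| by
      simp only [i, j, ne_eq, Fin.ext_iff] at h1 h2
      omega
    obtain ⟨w, hw⟩ := hc.exists_isHighestWeightVector
    have hj : Λ₀ j = 0 := by simp [hΛ, Gaudin.lam, Fin.ext_iff, j]
    obtain ⟨h1, h0⟩ := Gaudin.wordAct_replicate_ne_zero_of_singular hv₁ hv₀ (i := i) (j := j) rfl hj
      k (fun l h1 h2 => hk' l h2 h1) hw
    exact Gaudin.universalWeight_ne_zero hv₁ hji hk' h1 h0 ht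
  refine ⟨fun N hN V₁ V₀ => nonvanishing N hN V₁ V₀, ?_⟩
  rintro V₁ V₀ _ _ _ _ _ _ _ _ _ _ _ _ Λ₁ Λ₀ v₁ v₀ hv₁ hv₀ ⟨m, hΛ | hΛ⟩ x ⟨k, t, hc, ht, -, rfl⟩
  · exact nonvanishing 2 le_rfl V₁ V₀ Λ₁ Λ₀ v₁ v₀ hv₁ hv₀ m hΛ k (fun i hi => by omega) hc t ht
  · obtain ⟨w, hw⟩ := hc.exists_isHighestWeightVector
    -- After the flip the factor of highest weight mλ_1 comes second, as the Pieri argument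
    -- requires.
    have hw' := hw.comm
    rw [Gaudin.bigLambda, add_comm Λ₁] at hw'
    have hj : Λ₁ 1 = 0 := by simp [hΛ, Gaudin.lam, Fin.ext_iff]
    have hk (l : Fin 2) (h1 : l ≠ 0) (h2 : l ≠ 1) : k l = 0 := by
      omega
    obtain ⟨h0, h1⟩ := Gaudin.wordAct_replicate_ne_zero_of_singular hv₀ hv₁ (i := 0) (j := 1) rfl hj
      k hk hw'
    exact Gaudin.universalWeight_ne_zero hv₁ (by decide) hk h1 h0 ht
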